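/- A graph is a pair of sets $(V,E)$ with maps $\alpha,\omega:E\to V$ (source and destination) and $e\mapsto\overline e:E\to E$ satisfying $\overline{\overline e}=e$ and $\alpha(\overline e)=\omega(e)$ (loops, multiple edges and fixed points of the involution are allowed). For a locally finite graph $X$ with base point $*$, the circuit series of $(X,*)$ is $G_X(t)=\sum_{n\ge0}g_nt^n$, where $g_n$ is the number of sequences of edges $(e_1,\dots,e_n)$ forming a path of length $n$ from $*$ to $*$. For connected pointed graphs $(\mathcal E,*)$ and $(\mathcal F,*)$, the free product $\mathcal E*\mathcal F$ is obtained by gluing a copy of $\mathcal E$ and a copy of $\mathcal F$ at their base points, then gluing a copy of $\mathcal F$ (respectively $\mathcal E$) by its base point at every vertex other than $*$ of the copy of $\mathcal E$ (respectively $\mathcal F$), and repeating this forever at the newly created vertices; its base point is the common base point of the first two copies. For a power series $f$ with non-negative coefficients let $\rho(f)\in[0,\infty]$ be its radius of convergence; $f$ is recurrent if $f(t)\to\infty$ as $t\to\rho(f)$ from below (no condition if $\rho(f)=0$). Let $(\mathcal E,*)$ and $(\mathcal F,*)$ be connected, locally finite pointed graphs, let $\Gamma=\mathcal E*\mathcal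 F$, and suppose that the circuit series $G_{\mathcal E}$, $G_{\mathcal F}$ and $G_\Gamma$ (each at the base point) are all recurrent. Then $$\frac1{\rho(G_\Gamma)}=\frac1{\rho(G_{\mathcal E})}+\frac1{\rho(G_{\mathcal F})}$$ in $[0,\infty]$, with the convention $1/0=\infty$. -/

import Mathlib

open Filter Topology
open scoped ENNReal PowerSeries

universe u v u' v'

/-- A graph, possibly with loops and multiple edges: a set of vertices, a set of oriented edges,
and an involution on the edges that exchanges source and destination. The involution may have
fixed points. -/
structure InvGraph where
  /-- The vertices. -/
  V : Type u
  /-- The oriented edges. -/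
  E : Type v
  /-- The source of an edge. -/
  src : E → V
  /-- The destination of an edge. -/
  dst : E → V
  /-- The inverse of an edge. -/
  inv : E → E
  inv_inv : ∀ e, inv (inv e) = e
  src_inv : ∀ e, src (inv e) = dst e

namespace InvGraph

/-- `G.IsPath x p y`: the list of edges `p` is a path in `G` that starts at `x` and ends at `y`.
Its length is `p.length`. -/
def IsPath (G : InvGraph.{u, v}) : G.V → List G.E → G.V → Prop
  | x, [], y => x = y
  | x, e :: p, y => G.src e = x ∧ G.IsPath (G.dst e) p y

/-- Any two vertices are joined by a path. -/
def Connected (G : InvGraph.{u, v}) : Prop :=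
  ∀ x y : G.V, ∃ p : List G.E, G.IsPath x p y

/-- Every vertex has finite degree. -/
def LocallyFinite (G : InvGraph.{u, v}) : Prop :=
  ∀ x : G.V, {e : G.E | G.src e = x}.Finite

/-- The path series from `x` to `y`: the coefficient of `t ^ n` is the number of paths of
length `n` from `x` to `y` (a finite number if the graph is locally finite). -/
noncomputable def pathSeries (G : InvGraph.{u, v}) (x y : G.V) : ℕ⟦X⟧ :=
  PowerSeries.mk fun n => Set.ncard {p : List G.E | G.IsPath x p y ∧ p.length = n}

/-- The circuit series at `x`. -/
noncomputable def circuitSeries (G : InvGraph.{u, v}) (x : G.V) : ℕ⟦X⟧ :=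
  G.pathSeries x x

section FreeProduct

/-- A letter is a vertex of one of the two graphs other than its base point. -/
abbrev Letter (A : InvGraph.{u, v}) (B : InvGraph.{u', v'}) (a : A.V) (b : B.V) :
    Type (max u u') :=
  {x : A.V // x ≠ a} ⊕ {y : B.V // y ≠ b}

/-- Words whose letters come alternately from the two graphs. The word `l :: w` stands for the
vertex `l` in the copy of the factor of `l` that is glued at the vertex `w`. -/
abbrev FreeVertex (A : InvGraph.{u, v}) (B : InvGraph.{u', v'}) (a : A.V) (b : B.V) :
    Type (max u u') :=
  {w : List (Letter A B a b) // w.IsChain fun k l => k.isLeft ≠ l.isLeft}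

/-- The vertices of the free product at which the base point of a copy of `A` is glued: the
base point, and the vertices created as non-base vertices of a copy of `B`. -/
abbrev LeftSite (A : InvGraph.{u, v}) (B : InvGraph.{u', v'}) (a : A.V) (b : B.V) :
    Type (max u u') :=
  {w : FreeVertex A B a b // ∀ l ∈ w.1.head?, l.isRight}

/-- The vertices of the free product at which the base point of a copy of `B` is glued. -/
abbrev RightSite (A : InvGraph.{u, v}) (B : InvGraph.{u', v'}) (a : A.V) (b : B.V) :
    Type (max u u') :=
  {w : FreeVertex A B a b // ∀ l ∈ w.1.head?, l.isLeft}

variable {A : InvGraph.{u, v}} {B : InvGraph.{u', v'}} {a : A.V} {b : B.V}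

open Classical in
/-- The vertex `x` of the copy of `A` glued at `w`; the base point of this copy is `w` itself. -/
noncomputable def LeftSite.vertex (w : LeftSite A B a b) (x : A.V) : FreeVertex A B a b :=
  if h : x = a then w.1
  else ⟨Sum.inl ⟨x, h⟩ :: w.1.1, by
    refine List.isChain_cons.2 ⟨fun l hl => ?_, w.1.2⟩
    have := w.2 l hl
    cases l <;> simp_all⟩

open Classical in
/-- The vertex `y` of the copy of `B` glued at `w`; the base point of this copy is `w` itself. -/
noncomputable def RightSite.vertex (w : RightSite A B a b) (y : B.V) : FreeVertex A B a b :=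
  if h : y = b then w.1
  else ⟨Sum.inr ⟨y, h⟩ :: w.1.1, by
    refine List.isChain_cons.2 ⟨fun l hl => ?_, w.1.2⟩
    have := w.2 l hl
    cases l <;> simp_all⟩

/-- The free product of the pointed graphs `(A, a)` and `(B, b)`. Its edges are the edges of all
the copies of `A` and `B`. -/
noncomputable def freeProduct (A : InvGraph.{u, v}) (B : InvGraph.{u', v'}) (a : A.V) (b : B.V) :
    InvGraph.{max u u', max u u' v v'} where
  V := FreeVertex A B a b
  E := (LeftSite A B a b × A.E) ⊕ (RightSite A B a b × B.E)
  src := Sum.elim (fun p => p.1.vertex (A.src p.2)) (fun p => p.1.vertex (B.src p.2))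
  dst := Sum.elim (fun p => p.1.vertex (A.dst p.2)) (fun p => p.1.vertex (B.dst p.2))
  inv := Sum.map (fun p => (p.1, A.inv p.2)) (fun p => (p.1, B.inv p.2))
  inv_inv := by rintro (⟨w, e⟩ | ⟨w, e⟩) <;> simp [inv_inv]
  src_inv := by rintro (⟨w, e⟩ | ⟨w, e⟩) <;> simp [src_inv]

/-- The base point of the free product: the common base point of the first two copies. -/
def freeBase (A : InvGraph.{u, v}) (B : InvGraph.{u', v'}) (a : A.V) (b : B.V) :
    (freeProduct A B a b).V :=
  (⟨[], List.isChain_nil⟩ : FreeVertex A B a b)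

end FreeProduct

end InvGraph

/-- The radius of convergence `ρ(f) ∈ [0, ∞]`. -/
noncomputable def seriesRadius (f : ℕ⟦X⟧) : ℝ≥0∞ :=
  (FormalMultilinearSeries.ofScalars ℝ fun n => ((PowerSeries.coeff n f : ℕ) : ℝ)).radius

/-- The sum `f(t) ∈ [0, ∞]` of the series at `t ∈ [0, ∞]`. -/
noncomputable def seriesValue (f : ℕ⟦X⟧) (t : ℝ≥0∞) : ℝ≥0∞ :=
  ∑' n : ℕ, ((PowerSeries.coeff n f : ℕ) : ℝ≥0∞) * t ^ n

/-- `f` is recurrent: `f(t)` tends to infinity as `t` increases to the radius of convergence.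
(This puts no condition on a series with radius of convergence zero.) -/
def IsRecurrentSeries (f : ℕ⟦X⟧) : Prop :=
  Tendsto (seriesValue f) (𝓝[<] (seriesRadius f)) (𝓝 ∞)

/-! Write `u` for the Green function of the free product at parameter `t`: the weighted count of
paths from a variable vertex to the base point `o`. A Green function is the least solution of its
first-step equation, so a supersolution finite at the base point bounds the radius of convergence
from below. Both inequalities come from exhibiting supersolutions.

For `≤`, take `p`, `q` below the radii of the factors. Normalized Green functions of the factors
multiply along words to a function whose sum over the neighbours of a vertex is at most `p⁻¹ + q⁻¹`
times its value there. The series of the free product thus converges whenever `t * (p⁻¹ + q⁻¹) < 1`;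
then `p` and `q` tend to the radii (`inv_seriesRadius_freeProduct_le`).

For `≥`, split `g = u o` by the first edge as `1 + ψ + φ`, with `ψ` from `A` and `φ` from `B`.
Supermultiplicativity of `u / g` shows that the copy of `B` hanging at a vertex `x` of the root copy
of `A` contributes at least `u x * φ / g`. What remains for `A` makes `u` a supersolution on `A` of
parameter `t * g / (1 + ψ)`; exchange the factors for `B`. Adding the two bounds gives `t⁻¹ + t⁻¹ *
g⁻¹` (`add_inv_seriesRadius_le`), and recurrence removes the last term as `t` tends to the radius.
-/

/-! ### Radius of convergence and values in `[0, ∞]` -/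

theorem norm_ofScalars_coeff (f : ℕ⟦X⟧) (n : ℕ) :
    ‖FormalMultilinearSeries.ofScalars ℝ (fun n => ((PowerSeries.coeff n f : ℕ) : ℝ)) n‖ =
      ((PowerSeries.coeff n f : ℕ) : ℝ) := by
  simp

theorem seriesValue_lt_top_iff_summable (f : ℕ⟦X⟧) (t : NNReal) :
    seriesValue f t < ∞ ↔ Summable fun n => ((PowerSeries.coeff n f : ℕ) : ℝ) * (t : ℝ) ^ n := by
  have : seriesValue f t =
      ∑' n : ℕ, ((((PowerSeries.coeff n f : ℕ) : NNReal) * t ^ n : NNReal) : ℝ≥0∞) := by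
    simp [seriesValue]
  rw [this, lt_top_iff_ne_top, ENNReal.tsum_coe_ne_top_iff_summable, ← NNReal.summable_coe]
  simp

/-- A series converges inside its disc of convergence. -/
theorem seriesValue_lt_top {f : ℕ⟦X⟧} {t : ℝ≥0∞} (h : t < seriesRadius f) :
    seriesValue f t < ∞ := by
  lift t to NNReal using (h.trans_le le_top).ne
  rw [seriesValue_lt_top_iff_summable]
  simpa only [norm_ofScalars_coeff] using FormalMultilinearSeries.summable_norm_mul_pow _ h

/-- A point where the series converges is in the closed disc of convergence. -/
theorem le_seriesRadius {f : ℕ⟦X⟧} {t : ℝ≥0∞} (h : seriesValue f t < ∞) :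
    t ≤ seriesRadius f := by
  -- `t` may be infinite, so summability is tested at a finite `s` between `r` and `t`.
  refine le_of_forall_lt fun r hr => ?_
  obtain ⟨s, hrs, hst⟩ := exists_between hr
  refine hrs.trans_le ?_
  lift s to NNReal using (hst.trans_le le_top).ne
  have hs : seriesValue f s < ∞ := lt_of_le_of_lt
    (ENNReal.tsum_le_tsum fun n => by gcongr) h
  refine FormalMultilinearSeries.le_radius_of_summable _ ?_
  simpa only [norm_ofScalars_coeff] using (seriesValue_lt_top_iff_summable f s).1 hs

namespace InvGraph

/-! ### Path counts and Green functions -/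

open Classical in
/-- The number of paths of length `n` from `x` to `y`, possibly infinite. -/
noncomputable def pathCount (G : InvGraph.{u, v}) (y : G.V) : ℕ → G.V → ℝ≥0∞
  | 0, x => if x = y then 1 else 0
  | n + 1, x => ∑' e : {e : G.E // G.src e = x}, G.pathCount y n (G.dst e)

/-- The paths of length `n + 1` from `x` are given by a first edge and a path of length `n`. -/
def pathConsEquiv (G : InvGraph.{u, v}) (x y : G.V) (n : ℕ) :
    {p : List G.E // G.IsPath x p y ∧ p.length = n + 1} ≃
      Σ e : {e : G.E // G.src e = x}, {p : List G.E // G.IsPath (G.dst e) p y ∧ p.length = n} where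
  toFun
    | ⟨[], h⟩ => absurd h.2 (by simp)
    | ⟨e :: p, h⟩ => ⟨⟨e, h.1.1⟩, ⟨p, h.1.2, by simpa using h.2⟩⟩
  invFun q := ⟨q.1.1 :: q.2.1, ⟨q.1.2, q.2.2.1⟩, by simp [q.2.2.2]⟩
  left_inv
    | ⟨[], h⟩ => absurd h.2 (by simp)
    | ⟨e :: p, h⟩ => rfl
  right_inv q := rfl

theorem finite_paths {G : InvGraph.{u, v}} (hG : G.LocallyFinite) (y : G.V) (n : ℕ) (x : G.V) :
    Finite {p : List G.E // G.IsPath x p y ∧ p.length = n} := by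
  induction n generalizing x with
  | zero =>
    have : Subsingleton {p : List G.E // G.IsPath x p y ∧ p.length = 0} :=
      ⟨fun p q => Subtype.ext (by
        rw [List.length_eq_zero_iff.1 p.2.2, List.length_eq_zero_iff.1 q.2.2])⟩
    infer_instance
  | succ n ih =>
    have : Finite {e : G.E // G.src e = x} := (hG x).to_subtype
    exact Finite.of_equiv _ (G.pathConsEquiv x y n).symm

theorem tsum_one_eq_pathCount (G : InvGraph.{u, v}) (y : G.V) (n : ℕ) (x : G.V) :
    ∑' _ : {p : List G.E // G.IsPath x p y ∧ p.length = n}, (1 : ℝ≥0∞) = G.pathCount y n x := by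
  induction n generalizing x with
  | zero =>
    by_cases h : x = y
    · have : Unique {p : List G.E // G.IsPath x p y ∧ p.length = 0} :=
        { default := ⟨[], h, rfl⟩
          uniq := fun p => Subtype.ext (List.length_eq_zero_iff.1 p.2.2) }
      simp [pathCount, h, tsum_fintype]
    · have : IsEmpty {p : List G.E // G.IsPath x p y ∧ p.length = 0} :=
        ⟨fun p => h (by
          have := p.2.1
          rwa [List.length_eq_zero_iff.1 p.2.2] at this)⟩
      simp [pathCount, h]
  | succ n ih =>
    rw [← (G.pathConsEquiv x y n).symm.tsum_eq,
      ENNReal.tsum_sigma fun _ _ => (1 : ℝ≥0∞)]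
    simp only [ih, pathCount]

/-- `Set.ncard` vanishes on infinite sets; local finiteness is what makes it agree with the extended
count. -/
theorem coeff_pathSeries {G : InvGraph.{u, v}} (hG : G.LocallyFinite) (x y : G.V) (n : ℕ) :
    ((PowerSeries.coeff n (G.pathSeries x y) : ℕ) : ℝ≥0∞) = G.pathCount y n x := by
  rw [← tsum_one_eq_pathCount, pathSeries, PowerSeries.coeff_mk]
  have := finite_paths hG y n x
  have := Fintype.ofFinite {p : List G.E // G.IsPath x p y ∧ p.length = n}
  rw [tsum_fintype, ← Nat.card_coe_set_eq, Set.coe_ofPred, Nat.card_eq_fintype_card]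
  simp

/-- The sum of `t ^ n` over the paths of length `n < N` from `x` to `y`. -/
noncomputable def partialGreen (G : InvGraph.{u, v}) (y : G.V) (t : ℝ≥0∞) (N : ℕ) (x : G.V) :
    ℝ≥0∞ :=
  ∑ n ∈ Finset.range N, G.pathCount y n x * t ^ n

/-- The Green function: the sum of `t ^ n` over all the paths from `x` to `y`, where `n` is
the length of the path. -/
noncomputable def green (G : InvGraph.{u, v}) (y : G.V) (t : ℝ≥0∞) (x : G.V) : ℝ≥0∞ :=
  ∑' n, G.pathCount y n x * t ^ n

theorem seriesValue_circuitSeries {G : InvGraph.{u, v}} (hG : G.LocallyFinite) (x : G.V)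
    (t : ℝ≥0∞) : seriesValue (G.circuitSeries x) t = G.green x t x := by
  simp only [seriesValue, circuitSeries, green, coeff_pathSeries hG]

variable (G : InvGraph.{u, v}) (y : G.V) (t : ℝ≥0∞)

theorem partialGreen_le_green (N : ℕ) (x : G.V) : G.partialGreen y t N x ≤ G.green y t x :=
  ENNReal.sum_le_tsum _

open Classical in
theorem partialGreen_succ (N : ℕ) (x : G.V) : G.partialGreen y t (N + 1) x =
    (if x = y then 1 else 0) +
      t * ∑' e : {e : G.E // G.src e = x}, G.partialGreen y t N (G.dst e) := by
  simp only [partialGreen]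
  rw [Finset.sum_range_succ', add_comm, Summable.tsum_finsetSum fun _ _ => ENNReal.summable,
    Finset.mul_sum]
  congr 1
  · simp [pathCount]
  · refine Finset.sum_congr rfl fun n _ => ?_
    rw [pathCount, ENNReal.tsum_mul_right]
    ring

open Classical in
theorem green_eq (x : G.V) : G.green y t x = (if x = y then 1 else 0) +
      t * ∑' e : {e : G.E // G.src e = x}, G.green y t (G.dst e) := by
  simp only [green]
  rw [tsum_eq_zero_add' ENNReal.summable, ENNReal.tsum_comm, ← ENNReal.tsum_mul_left]
  congr 1
  · simp [pathCount]
  · refine tsum_congr fun n => ?_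
    rw [pathCount, ENNReal.tsum_mul_right]
    ring

variable {G y t}

theorem green_le_of_partialGreen_le {x : G.V} {c : ℝ≥0∞}
    (h : ∀ N, G.partialGreen y t N x ≤ c) : G.green y t x ≤ c :=
  ENNReal.tsum_le_of_sum_range_le h

open Classical in
/-- The Green function is the least solution of the equation `green_eq`. -/
theorem green_le_of_supersolution {w : G.V → ℝ≥0∞}
    (h : ∀ x, (if x = y then 1 else 0) +
      t * ∑' e : {e : G.E // G.src e = x}, w (G.dst e) ≤ w x) (x : G.V) :
    G.green y t x ≤ w x := by
  refine green_le_of_partialGreen_le fun N => ?_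
  induction N generalizing x with
  | zero => simp [partialGreen]
  | succ N ih =>
    rw [partialGreen_succ]
    refine le_trans ?_ (h x)
    gcongr
    exact ih _

section FreeProduct

/-! ### Local structure of the free product -/

variable {A : InvGraph.{u, v}} {B : InvGraph.{u', v'}} {a : A.V} {b : B.V}

theorem LeftSite.vertex_base (s : LeftSite A B a b) : s.vertex a = s.1 := by
  simp [LeftSite.vertex]

theorem RightSite.vertex_base (s : RightSite A B a b) : s.vertex b = s.1 := by
  simp [RightSite.vertex]

theorem LeftSite.vertex_val_of_ne (s : LeftSite A B a b) {x : A.V} (h : x ≠ a) :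
    (s.vertex x).1 = Sum.inl ⟨x, h⟩ :: s.1.1 := by
  simp [LeftSite.vertex, h]

theorem RightSite.vertex_val_of_ne (s : RightSite A B a b) {y : B.V} (h : y ≠ b) :
    (s.vertex y).1 = Sum.inr ⟨y, h⟩ :: s.1.1 := by
  simp [RightSite.vertex, h]

/-- A left site never has a letter of `A` at its head, so the head of a word tells whether it is the
base point of its copy of `A`. Copies of `A` are therefore disjoint. -/
theorem LeftSite.vertex_injective {s s' : LeftSite A B a b} {x x' : A.V}
    (h : s.vertex x = s'.vertex x') : s = s' ∧ x = x' := by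
  have h1 := congrArg Subtype.val h
  by_cases hx : x = a <;> by_cases hx' : x' = a
  · subst hx hx'
    simp only [vertex_base] at h
    exact ⟨Subtype.ext h, rfl⟩
  · subst hx
    rw [vertex_base, vertex_val_of_ne _ hx'] at h1
    have := s.2 (Sum.inl ⟨x', hx'⟩)
    simp [h1] at this
  · subst hx'
    rw [vertex_base, vertex_val_of_ne _ hx] at h1
    have := s'.2 (Sum.inl ⟨x, hx⟩)
    simp [← h1] at this
  · rw [vertex_val_of_ne _ hx, vertex_val_of_ne _ hx'] at h1
    simp only [List.cons.injEq, Sum.inl.injEq, Subtype.mk.injEq] at h1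
    exact ⟨Subtype.ext (Subtype.ext h1.2), h1.1⟩

theorem RightSite.vertex_injective {s s' : RightSite A B a b} {y y' : B.V}
    (h : s.vertex y = s'.vertex y') : s = s' ∧ y = y' := by
  have h1 := congrArg Subtype.val h
  by_cases hy : y = b <;> by_cases hy' : y' = b
  · subst hy hy'
    simp only [vertex_base] at h
    exact ⟨Subtype.ext h, rfl⟩
  · subst hy
    rw [vertex_base, vertex_val_of_ne _ hy'] at h1
    have := s.2 (Sum.inr ⟨y', hy'⟩)
    simp [h1] at this
  · subst hy'
    rw [vertex_base, vertex_val_of_ne _ hy] at h1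
    have := s'.2 (Sum.inr ⟨y, hy⟩)
    simp [← h1] at this
  · rw [vertex_val_of_ne _ hy, vertex_val_of_ne _ hy'] at h1
    simp only [List.cons.injEq, Sum.inr.injEq, Subtype.mk.injEq] at h1
    exact ⟨Subtype.ext (Subtype.ext h1.2), h1.1⟩

/-- Every vertex of the free product lies in a copy of `A` and in a copy of `B`, and is the base
point of one of them. -/
theorem exists_vertex_eq (w : FreeVertex A B a b) :
    ∃ (s : LeftSite A B a b) (x : A.V) (r : RightSite A B a b) (y : B.V),
      s.vertex x = w ∧ r.vertex y = w := by
  obtain ⟨l, hl⟩ := w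
  match l, hl with
  | [], hl =>
    exact ⟨⟨⟨[], hl⟩, by simp⟩, a, ⟨⟨[], hl⟩, by simp⟩, b, LeftSite.vertex_base _,
      RightSite.vertex_base _⟩
  | Sum.inl x :: l, hl =>
    have h := List.isChain_cons.1 hl
    refine ⟨⟨⟨l, h.2⟩, fun k hk => ?_⟩, x.1, ⟨⟨_, hl⟩, by simp⟩, b, Subtype.ext ?_,
      RightSite.vertex_base _⟩
    · simpa using h.1 k hk
    · rw [LeftSite.vertex_val_of_ne _ x.2]
  | Sum.inr y :: l, hl =>
    have h := List.isChain_cons.1 hl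
    refine ⟨⟨⟨_, hl⟩, by simp⟩, a, ⟨⟨l, h.2⟩, fun k hk => ?_⟩, y.1, LeftSite.vertex_base _,
      Subtype.ext ?_⟩
    · simpa using h.1 k hk
    · rw [RightSite.vertex_val_of_ne _ y.2]

/-- The edges of the free product that start at a given vertex. -/
def edgesEquiv (s : LeftSite A B a b) (x : A.V) (r : RightSite A B a b) (y : B.V)
    (h : s.vertex x = r.vertex y) :
    {e : A.E // A.src e = x} ⊕ {e : B.E // B.src e = y} ≃
      {e : (A.freeProduct B a b).E // (A.freeProduct B a b).src e = s.vertex x} where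
  toFun := Sum.elim
    (fun e => ⟨Sum.inl (s, e.1), congrArg s.vertex e.2⟩)
    (fun e => ⟨Sum.inr (r, e.1), (congrArg r.vertex e.2).trans h.symm⟩)
  invFun
    | ⟨Sum.inl p, hp⟩ => Sum.inl ⟨p.2, (LeftSite.vertex_injective hp).2⟩
    | ⟨Sum.inr p, hp⟩ => Sum.inr ⟨p.2, (RightSite.vertex_injective (hp.trans h)).2⟩
  left_inv := by rintro (e | e) <;> rfl
  right_inv := by
    rintro ⟨⟨s', e⟩ | ⟨r', e⟩, hp⟩
    · obtain rfl := (LeftSite.vertex_injective hp).1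
      rfl
    · obtain rfl := (RightSite.vertex_injective (hp.trans h)).1
      rfl

theorem LocallyFinite.freeProduct (hA : A.LocallyFinite) (hB : B.LocallyFinite) :
    (A.freeProduct B a b).LocallyFinite := by
  intro w
  obtain ⟨s, x, r, y, rfl, hr⟩ := exists_vertex_eq w
  have : Finite {e : A.E // A.src e = x} := (hA x).to_subtype
  have : Finite {e : B.E // B.src e = y} := (hB y).to_subtype
  have : Finite {e : (A.freeProduct B a b).E // (A.freeProduct B a b).src e = s.vertex x} :=
    Finite.of_equiv _ (edgesEquiv s x r y hr.symm)
  exact Set.finite_coe_iff.1 this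

theorem tsum_edges_freeProduct (u : FreeVertex A B a b → ℝ≥0∞) {w : FreeVertex A B a b}
    {s : LeftSite A B a b} {x : A.V} {r : RightSite A B a b} {y : B.V}
    (hs : s.vertex x = w) (hr : r.vertex y = w) :
    ∑' e : {e : (A.freeProduct B a b).E // (A.freeProduct B a b).src e = w},
        u ((A.freeProduct B a b).dst e) =
      ∑' e : {e : A.E // A.src e = x}, u (s.vertex (A.dst e)) +
        ∑' e : {e : B.E // B.src e = y}, u (r.vertex (B.dst e)) := by
  subst hs
  rw [← (edgesEquiv s x r y hr.symm).tsum_eq, ENNReal.summable.tsum_sum ENNReal.summable]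
  rfl

theorem LeftSite.vertex_append {s s' : LeftSite A B a b} {l : List (Letter A B a b)}
    (h : s'.1.1 = s.1.1 ++ l) (x : A.V) : (s'.vertex x).1 = (s.vertex x).1 ++ l := by
  by_cases hx : x = a
  · rw [hx, vertex_base, vertex_base, h]
  · rw [vertex_val_of_ne _ hx, vertex_val_of_ne _ hx, h, List.cons_append]

theorem RightSite.vertex_append {r r' : RightSite A B a b} {l : List (Letter A B a b)}
    (h : r'.1.1 = r.1.1 ++ l) (y : B.V) : (r'.vertex y).1 = (r.vertex y).1 ++ l := by
  by_cases hy : y = b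
  · rw [hy, vertex_base, vertex_base, h]
  · rw [vertex_val_of_ne _ hy, vertex_val_of_ne _ hy, h, List.cons_append]

/-- The neighbourhood of a vertex other than the base point does not change when the same word is
appended to all the vertices. -/
theorem exists_vertex_eq_append {w w' : FreeVertex A B a b} {l : List (Letter A B a b)}
    (hw : w.1 ≠ []) (h : w'.1 = w.1 ++ l) :
    ∃ (s s' : LeftSite A B a b) (x : A.V) (r r' : RightSite A B a b) (y : B.V),
      s.vertex x = w ∧ s'.vertex x = w' ∧ r.vertex y = w ∧ r'.vertex y = w' ∧
        s'.1.1 = s.1.1 ++ l ∧ r'.1.1 = r.1.1 ++ l := by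
  obtain ⟨m, hm⟩ := w
  obtain ⟨m', hm'⟩ := w'
  dsimp only at h hw
  subst h
  match m, hm, hw, hm' with
  | Sum.inl x :: m, hm, _, hm' =>
    have h := List.isChain_cons.1 hm
    have h' := List.isChain_cons.1 hm'
    refine ⟨⟨⟨m, h.2⟩, fun k hk => by simpa using h.1 k hk⟩,
      ⟨⟨m ++ l, h'.2⟩, fun k hk => by simpa using h'.1 k hk⟩, x.1,
      ⟨⟨_, hm⟩, by simp⟩, ⟨⟨_, hm'⟩, by simp⟩, b, Subtype.ext ?_, Subtype.ext ?_,
      RightSite.vertex_base _, RightSite.vertex_base _, rfl, rfl⟩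
    · rw [LeftSite.vertex_val_of_ne _ x.2]
    · rw [LeftSite.vertex_val_of_ne _ x.2]
      rfl
  | Sum.inr y :: m, hm, _, hm' =>
    have h := List.isChain_cons.1 hm
    have h' := List.isChain_cons.1 hm'
    refine ⟨⟨⟨_, hm⟩, by simp⟩, ⟨⟨_, hm'⟩, by simp⟩, a,
      ⟨⟨m, h.2⟩, fun k hk => by simpa using h.1 k hk⟩,
      ⟨⟨m ++ l, h'.2⟩, fun k hk => by simpa using h'.1 k hk⟩, y.1,
      LeftSite.vertex_base _, LeftSite.vertex_base _, Subtype.ext ?_, Subtype.ext ?_, rfl, rfl⟩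
    · rw [RightSite.vertex_val_of_ne _ y.2]
    · rw [RightSite.vertex_val_of_ne _ y.2]
      rfl

/-! ### Green function of the free product -/

variable (A B a b) in
/-- The empty word. -/
def emptyVertex : FreeVertex A B a b := ⟨[], List.isChain_nil⟩

variable (A B a b) in
/-- The partial sums of the Green function of the free product. -/
noncomputable def freePartialGreen (t : ℝ≥0∞) (N : ℕ) (w : FreeVertex A B a b) : ℝ≥0∞ :=
  (A.freeProduct B a b).partialGreen (A.freeBase B a b) t N w

variable (A B a b) in
/-- The Green function of the free product. -/
noncomputable def freeGreen (t : ℝ≥0∞) (w : FreeVertex A B a b) : ℝ≥0∞ :=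
  (A.freeProduct B a b).green (A.freeBase B a b) t w

theorem freePartialGreen_succ (t : ℝ≥0∞) (N : ℕ) {w : FreeVertex A B a b}
    (hw : w ≠ emptyVertex A B a b)
    {s : LeftSite A B a b} {x : A.V} {r : RightSite A B a b} {y : B.V}
    (hs : s.vertex x = w) (hr : r.vertex y = w) :
    freePartialGreen A B a b t (N + 1) w =
      t * (∑' e : {e : A.E // A.src e = x}, freePartialGreen A B a b t N (s.vertex (A.dst e)) +
        ∑' e : {e : B.E // B.src e = y}, freePartialGreen A B a b t N (r.vertex (B.dst e))) :=
  (partialGreen_succ _ _ _ _ _).trans (((congrArg (· + _) (if_neg hw)).trans (zero_add _)).trans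
    (congrArg (t * ·) (tsum_edges_freeProduct (freePartialGreen A B a b t N) hs hr)))

theorem freeGreen_emptyVertex (t : ℝ≥0∞)
    {s : LeftSite A B a b} {x : A.V} {r : RightSite A B a b} {y : B.V}
    (hs : s.vertex x = emptyVertex A B a b) (hr : r.vertex y = emptyVertex A B a b) :
    freeGreen A B a b t (emptyVertex A B a b) =
      1 + t * (∑' e : {e : A.E // A.src e = x}, freeGreen A B a b t (s.vertex (A.dst e)) +
        ∑' e : {e : B.E // B.src e = y}, freeGreen A B a b t (r.vertex (B.dst e))) :=
  (green_eq _ _ _ _).trans ((congrArg (· + _) (if_pos rfl)).trans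
    (congrArg (1 + t * ·) (tsum_edges_freeProduct (freeGreen A B a b t) hs hr)))

/-- The source term is dropped, so that the base point needs no separate treatment. -/
theorem le_freeGreen (t : ℝ≥0∞) {w : FreeVertex A B a b}
    {s : LeftSite A B a b} {x : A.V} {r : RightSite A B a b} {y : B.V}
    (hs : s.vertex x = w) (hr : r.vertex y = w) :
    t * (∑' e : {e : A.E // A.src e = x}, freeGreen A B a b t (s.vertex (A.dst e)) +
        ∑' e : {e : B.E // B.src e = y}, freeGreen A B a b t (r.vertex (B.dst e))) ≤
      freeGreen A B a b t w :=
  (le_of_eq (congrArg (t * ·) (tsum_edges_freeProduct (freeGreen A B a b t) hs hr).symm)).trans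
    (le_add_self.trans_eq (green_eq _ _ _ _).symm)

/-- A path from `w ++ z` to the base point must pass through `z`, and until then it moves as a path
from `w` to the base point does. Only this inequality is needed, and induction on the length bound
proves it without first-passage decompositions. -/
theorem freePartialGreen_mul_le_append (t : ℝ≥0∞) (N : ℕ) {w w' z : FreeVertex A B a b}
    (h : w'.1 = w.1 ++ z.1) :
    freePartialGreen A B a b t N w * freeGreen A B a b t z ≤
      freeGreen A B a b t w' * freeGreen A B a b t (emptyVertex A B a b) := by
  induction N generalizing w w' with
  | zero => simp [freePartialGreen, partialGreen]
  | succ N ih =>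
    -- The source term occurs only at the empty word, where `w' = z` and a partial sum is compared
    -- with the full sum.
    by_cases hw : w.1 = []
    · obtain rfl : w' = z := Subtype.ext (by simpa [hw] using h)
      obtain rfl : w = emptyVertex A B a b := Subtype.ext hw
      rw [mul_comm]
      gcongr
      exact partialGreen_le_green _ _ _ _ _
    · obtain ⟨s, s', x, r, r', y, hs, hs', hr, hr', hss, hrr⟩ := exists_vertex_eq_append hw h
      rw [freePartialGreen_succ t N (fun h => hw (congrArg Subtype.val h)) hs hr]
      refine le_trans ?_ (mul_le_mul_left (le_freeGreen t hs' hr') _)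
      rw [mul_assoc, mul_assoc, add_mul, add_mul, ← ENNReal.tsum_mul_right,
        ← ENNReal.tsum_mul_right, ← ENNReal.tsum_mul_right, ← ENNReal.tsum_mul_right]
      refine mul_le_mul_right (add_le_add (ENNReal.tsum_le_tsum fun e => ?_)
        (ENNReal.tsum_le_tsum fun e => ?_)) t
      · exact ih (LeftSite.vertex_append hss _)
      · exact ih (RightSite.vertex_append hrr _)

/-- The Green function of the free product is supermultiplicative after division by its value at
the base point. -/
theorem freeGreen_mul_le_append (t : ℝ≥0∞) {w w' z : FreeVertex A B a b}
    (h : w'.1 = w.1 ++ z.1) :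
    freeGreen A B a b t w * freeGreen A B a b t z ≤
      freeGreen A B a b t w' * freeGreen A B a b t (emptyVertex A B a b) := by
  refine le_of_eq_of_le ENNReal.tsum_mul_right.symm
    (ENNReal.tsum_le_of_sum_range_le fun N => ?_)
  rw [← Finset.sum_mul]
  exact freePartialGreen_mul_le_append t N h

/-! ### Restriction to a factor: the inequality `≥` -/

/-- A lower bound on the radius of convergence from a function that satisfies the equation of the
Green function up to a factor. -/
theorem inv_seriesRadius_le {G : InvGraph.{u, v}} (hG : G.LocallyFinite) {o : G.V}
    {t g φ ψ : ℝ≥0∞} (hg : g = 1 + ψ + φ) (hg' : g ≠ ∞) {U : G.V → ℝ≥0∞} (hU : U o = g)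
    (h : ∀ x, g * (t * ∑' e : {e : G.E // G.src e = x}, U (G.dst e)) + U x * φ ≤ U x * g)
    (h' : g * (1 + t * ∑' e : {e : G.E // G.src e = o}, U (G.dst e)) + g * φ ≤ g * g) :
    (seriesRadius (G.circuitSeries o))⁻¹ ≤ t⁻¹ * (1 + ψ) * g⁻¹ := by
  classical
  have hψ : 1 + ψ ≠ ∞ := fun h => hg' (by rw [hg, h, top_add])
  have hφ : φ ≠ ∞ := fun h => hg' (by rw [hg, h, add_top])
  have hψ0 : 1 + ψ ≠ 0 := by simp
  have hg0 : g ≠ 0 := by rw [hg]; simp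
  have key : ∀ x, g * ((if x = o then 1 else 0) +
      t * ∑' e : {e : G.E // G.src e = x}, U (G.dst e)) ≤ U x * (1 + ψ) := by
    intro x
    -- Cancelling `U x * φ` requires it to be finite.
    by_cases hx : U x = ∞
    · rw [hx, ENNReal.top_mul hψ0]
      exact le_top
    · refine (ENNReal.add_le_add_iff_right (ENNReal.mul_ne_top hx hφ)).1 ?_
      rw [← mul_add, ← hg]
      split_ifs with hxo
      · subst hxo
        rwa [hU]
      · rw [zero_add]
        exact h x
  -- Dividing `key` by `g` turns its source term into 1; the factor `(1 + ψ) * g⁻¹` gained by `U` is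
  -- compensated in the parameter.
  have hle : G.green o (t * g * (1 + ψ)⁻¹) o ≤ U o * ((1 + ψ) * g⁻¹) := by
    refine green_le_of_supersolution (w := fun x => U x * ((1 + ψ) * g⁻¹)) (fun x => ?_) o
    rw [ENNReal.tsum_mul_right]
    have : U x * ((1 + ψ) * g⁻¹) = U x * (1 + ψ) * g⁻¹ := by ring
    rw [this]
    refine le_trans (le_of_eq ?_) (mul_le_mul_left (key x) g⁻¹)
    rw [mul_right_comm g, ENNReal.mul_inv_cancel hg0 hg', one_mul]
    congr 1
    calc _ = t * (g * g⁻¹) * ((1 + ψ) * (1 + ψ)⁻¹) *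
          ∑' e : {e : G.E // G.src e = x}, U (G.dst e) := by ring
      _ = _ := by
        rw [ENNReal.mul_inv_cancel hg0 hg', ENNReal.mul_inv_cancel hψ0 hψ, mul_one, mul_one]
  have hfin : seriesValue (G.circuitSeries o) (t * g * (1 + ψ)⁻¹) < ∞ := by
    rw [seriesValue_circuitSeries hG]
    refine lt_of_le_of_lt hle ?_
    rw [hU]
    exact ENNReal.mul_lt_top hg'.lt_top (ENNReal.mul_lt_top hψ.lt_top (by simpa using hg0.bot_lt))
  refine (ENNReal.inv_le_inv.2 (le_seriesRadius hfin)).trans (le_of_eq ?_)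
  rw [ENNReal.mul_inv (Or.inr (ENNReal.inv_ne_top.2 hψ0)) (Or.inr (ENNReal.inv_ne_zero.2 hψ)),
    ENNReal.mul_inv (Or.inr hg') (Or.inr hg0), _root_.inv_inv]
  ring

/-- Below the radius of convergence of the free product, restricting its Green function to a copy of
a factor bounds the radius of that factor. -/
theorem add_inv_seriesRadius_le (hA : A.LocallyFinite) (hB : B.LocallyFinite) {t : ℝ≥0∞}
    (ht : seriesValue ((A.freeProduct B a b).circuitSeries (A.freeBase B a b)) t < ∞) :
    (seriesRadius (A.circuitSeries a))⁻¹ + (seriesRadius (B.circuitSeries b))⁻¹ ≤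
      t⁻¹ + t⁻¹ * (seriesValue ((A.freeProduct B a b).circuitSeries (A.freeBase B a b)) t)⁻¹ := by
  rw [seriesValue_circuitSeries (hA.freeProduct hB)] at ht ⊢
  set o := emptyVertex A B a b with ho
  set u := freeGreen A B a b t with hu
  change u o < ∞ at ht
  change _ ≤ t⁻¹ + t⁻¹ * (u o)⁻¹
  let s₀ : LeftSite A B a b := ⟨o, by simp [ho, emptyVertex]⟩
  let r₀ : RightSite A B a b := ⟨o, by simp [ho, emptyVertex]⟩
  set ψ := t * ∑' e : {e : A.E // A.src e = a}, u (s₀.vertex (A.dst e)) with hψ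
  set φ := t * ∑' e : {e : B.E // B.src e = b}, u (r₀.vertex (B.dst e)) with hφ
  have hg : u o = 1 + ψ + φ := by
    rw [hu, freeGreen_emptyVertex t s₀.vertex_base r₀.vertex_base, mul_add, add_assoc]
  have hgt : u o ≠ ∞ := ht.ne
  have hg0 : u o ≠ 0 := by rw [hg]; simp
  have h1 : (seriesRadius (A.circuitSeries a))⁻¹ ≤ t⁻¹ * (1 + ψ) * (u o)⁻¹ := by
    refine inv_seriesRadius_le hA hg hgt (U := fun x => u (s₀.vertex x))
      (congrArg u s₀.vertex_base) (fun x => ?_) ?_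
    -- The copy of `B` hanging at `x`; it is the root copy when `x = a`.
    · let r : RightSite A B a b := ⟨s₀.vertex x, by
        by_cases hx : x = a
        · rw [hx, s₀.vertex_base]
          exact r₀.2
        · simp [s₀.vertex_val_of_ne hx]⟩
      have hr : r.1.1 = r₀.1.1 ++ (s₀.vertex x).1 := rfl
      have : u (s₀.vertex x) * φ ≤
          (t * ∑' e : {e : B.E // B.src e = b}, u (r.vertex (B.dst e))) * u o := by
        rw [hφ, mul_left_comm, mul_assoc, ← ENNReal.tsum_mul_left, ← ENNReal.tsum_mul_right]
        refine mul_le_mul_right (ENNReal.tsum_le_tsum fun e => ?_) t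
        rw [mul_comm]
        exact freeGreen_mul_le_append t (RightSite.vertex_append hr _)
      calc _ ≤ u o * (t * ∑' e : {e : A.E // A.src e = x}, u (s₀.vertex (A.dst e))) +
            (t * ∑' e : {e : B.E // B.src e = b}, u (r.vertex (B.dst e))) * u o := by gcongr
        _ = (t * (∑' e : {e : A.E // A.src e = x}, u (s₀.vertex (A.dst e)) +
            ∑' e : {e : B.E // B.src e = b}, u (r.vertex (B.dst e)))) * u o := by ring
        _ ≤ _ := by
          gcongr
          exact le_freeGreen t rfl r.vertex_base
    · rw [← hψ, ← mul_add, ← hg]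
  have h2 : (seriesRadius (B.circuitSeries b))⁻¹ ≤ t⁻¹ * (1 + φ) * (u o)⁻¹ := by
    refine inv_seriesRadius_le hB (hg.trans (add_right_comm _ _ _)) hgt
      (U := fun y => u (r₀.vertex y)) (congrArg u r₀.vertex_base) (fun y => ?_) ?_
    · let s : LeftSite A B a b := ⟨r₀.vertex y, by
        by_cases hy : y = b
        · rw [hy, r₀.vertex_base]
          exact s₀.2
        · simp [r₀.vertex_val_of_ne hy]⟩
      have hs : s.1.1 = s₀.1.1 ++ (r₀.vertex y).1 := rfl
      have : u (r₀.vertex y) * ψ ≤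
          (t * ∑' e : {e : A.E // A.src e = a}, u (s.vertex (A.dst e))) * u o := by
        rw [hψ, mul_left_comm, mul_assoc, ← ENNReal.tsum_mul_left, ← ENNReal.tsum_mul_right]
        refine mul_le_mul_right (ENNReal.tsum_le_tsum fun e => ?_) t
        rw [mul_comm]
        exact freeGreen_mul_le_append t (LeftSite.vertex_append hs _)
      calc _ ≤ u o * (t * ∑' e : {e : B.E // B.src e = y}, u (r₀.vertex (B.dst e))) +
            (t * ∑' e : {e : A.E // A.src e = a}, u (s.vertex (A.dst e))) * u o := by gcongr
        _ = (t * (∑' e : {e : A.E // A.src e = a}, u (s.vertex (A.dst e)) +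
            ∑' e : {e : B.E // B.src e = y}, u (r₀.vertex (B.dst e)))) * u o := by ring
        _ ≤ _ := by
          gcongr
          exact le_freeGreen t s.vertex_base rfl
    · rw [← hφ, ← mul_add, add_right_comm, ← hg]
  -- The empty path is counted in both bounds: `(1 + ψ) + (1 + φ) = g + 1`, whence the error term
  -- `t⁻¹ * g⁻¹`.
  calc _ ≤ t⁻¹ * (1 + ψ) * (u o)⁻¹ + t⁻¹ * (1 + φ) * (u o)⁻¹ := add_le_add h1 h2
    _ = t⁻¹ * ((1 + ψ + φ) * (u o)⁻¹) + t⁻¹ * (u o)⁻¹ := by ring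
    _ = _ := by rw [← hg, ENNReal.mul_inv_cancel hg0 hgt, mul_one]

/-! ### Products of supersolutions: the inequality `≤` -/

/-- A supersolution away from the base point, of parameter `s` less than the radius of
convergence and normalized at the base point. -/
theorem exists_normalized_supersolution {G : InvGraph.{u, v}} (hG : G.LocallyFinite) (o : G.V)
    {s : ℝ≥0∞} (hs : s < seriesRadius (G.circuitSeries o)) :
    ∃ f : G.V → ℝ≥0∞, f o = 1 ∧
      ∀ x, s * ∑' e : {e : G.E // G.src e = x}, f (G.dst e) ≤ f x := by
  have hfin := seriesValue_lt_top hs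
  rw [seriesValue_circuitSeries hG] at hfin
  have h0 : G.green o s o ≠ 0 := by rw [green_eq, if_pos rfl]; simp
  refine ⟨fun x => G.green o s x * (G.green o s o)⁻¹, ENNReal.mul_inv_cancel h0 hfin.ne,
    fun x => ?_⟩
  dsimp only
  rw [ENNReal.tsum_mul_right, ← mul_assoc]
  gcongr
  rw [green_eq _ _ _ x]
  exact le_add_self

/-- Products of normalized supersolutions of the factors give a supersolution of the free product. -/
theorem inv_seriesRadius_freeProduct_le (hA : A.LocallyFinite) (hB : B.LocallyFinite)
    {p q : ℝ≥0∞} (hp : p < seriesRadius (A.circuitSeries a))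
    (hq : q < seriesRadius (B.circuitSeries b)) :
    (seriesRadius ((A.freeProduct B a b).circuitSeries (A.freeBase B a b)))⁻¹ ≤ p⁻¹ + q⁻¹ := by
  obtain rfl | hp0 := eq_or_ne p 0
  · simp
  obtain rfl | hq0 := eq_or_ne q 0
  · simp
  obtain ⟨f, hf, hf'⟩ := exists_normalized_supersolution hA a hp
  obtain ⟨k, hk, hk'⟩ := exists_normalized_supersolution hB b hq
  have hpt : p ≠ ∞ := (hp.trans_le le_top).ne
  have hqt : q ≠ ∞ := (hq.trans_le le_top).ne
  refine ENNReal.inv_le_iff_inv_le.2 ?_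
  refine le_of_forall_lt fun t ht => ?_
  obtain ⟨t, htt, ht⟩ := exists_between ht
  refine htt.trans_le (le_seriesRadius ?_)
  rw [seriesValue_circuitSeries (hA.freeProduct hB)]
  set d := t * (p⁻¹ + q⁻¹) with hd
  have hd1 : d < 1 := by
    rw [← one_div] at ht
    exact ENNReal.mul_lt_of_lt_div ht
  -- The factor `(1 - d)⁻¹` absorbs the source at the base point: `1 + d * (1 - d)⁻¹ = (1 - d)⁻¹`.
  let v : FreeVertex A B a b → ℝ≥0∞ := fun w =>
    (1 - d)⁻¹ * (w.1.map (Sum.elim (fun x => f x.1) (fun y => k y.1))).prod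
  have hvL : ∀ (s : LeftSite A B a b) x, v (s.vertex x) = f x * v s.1 := by
    intro s x
    by_cases hx : x = a
    · rw [hx, s.vertex_base, hf, one_mul]
    · simp only [v, s.vertex_val_of_ne hx, List.map_cons, List.prod_cons, Sum.elim_inl]
      ring
  have hvR : ∀ (r : RightSite A B a b) y, v (r.vertex y) = k y * v r.1 := by
    intro r y
    by_cases hy : y = b
    · rw [hy, r.vertex_base, hk, one_mul]
    · simp only [v, r.vertex_val_of_ne hy, List.map_cons, List.prod_cons, Sum.elim_inr]
      ring
  have hv : ∀ w, t * ∑' e : {e : (A.freeProduct B a b).E // (A.freeProduct B a b).src e = w},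
      v ((A.freeProduct B a b).dst e) ≤ d * v w := by
    intro w
    obtain ⟨s, x, r, y, hs, hr⟩ := exists_vertex_eq w
    rw [tsum_edges_freeProduct v hs hr]
    simp only [hvL, hvR, ENNReal.tsum_mul_right]
    rw [hd, mul_assoc, add_mul]
    refine mul_le_mul_right (add_le_add ?_ ?_) t
    · rw [← hs, hvL, ← mul_assoc p⁻¹]
      exact mul_le_mul_left ((ENNReal.mul_le_iff_le_inv hp0 hpt).1 (hf' x)) _
    · rw [← hr, hvR, ← mul_assoc q⁻¹]
      exact mul_le_mul_left ((ENNReal.mul_le_iff_le_inv hq0 hqt).1 (hk' y)) _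
  refine lt_of_le_of_lt (green_le_of_supersolution (w := v) (fun w => ?_) _) (?_ : v _ < ∞)
  · split_ifs with hw
    · subst hw
      have : v (A.freeBase B a b) = (1 - d)⁻¹ := by simp [v, freeBase]
      refine (add_le_add_right (hv _) 1).trans (le_of_eq ?_)
      have hd0 : 1 - d ≠ 0 := (tsub_pos_of_lt hd1).ne'
      have hdt : 1 - d ≠ ∞ := ENNReal.sub_ne_top ENNReal.one_ne_top
      rw [this]
      nth_rw 1 [← ENNReal.mul_inv_cancel hd0 hdt]
      rw [← add_mul, tsub_add_cancel_of_le hd1.le, one_mul]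
    · rw [zero_add]
      exact (hv w).trans (mul_le_of_le_one_left' hd1.le)
  · simpa [v, freeBase] using hd1

end FreeProduct

end InvGraph

/-- The inequality `≤` holds without recurrence; the inequality `≥` uses the recurrence of the free
product. -/
theorem mainTheorem11 (A : InvGraph.{u, v}) (B : InvGraph.{u', v'}) (a : A.V) (b : B.V)
    (hA : A.Connected) (hB : B.Connected)
    (hA' : A.LocallyFinite) (hB' : B.LocallyFinite)
    (recA : IsRecurrentSeries (A.circuitSeries a))
    (recB : IsRecurrentSeries (B.circuitSeries b))
    (recAB : IsRecurrentSeries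
      ((A.freeProduct B a b).circuitSeries (A.freeBase B a b))) :
    (seriesRadius ((A.freeProduct B a b).circuitSeries (A.freeBase B a b)))⁻¹ =
      (seriesRadius (A.circuitSeries a))⁻¹ + (seriesRadius (B.circuitSeries b))⁻¹ := by
  set ρ := seriesRadius ((A.freeProduct B a b).circuitSeries (A.freeBase B a b)) with hρ
  set ρA := seriesRadius (A.circuitSeries a) with hρA
  set ρB := seriesRadius (B.circuitSeries b) with hρB
  apply le_antisymm
  -- A zero radius makes the right side infinite; it is set aside because nothing lies below 0 to
  -- take the limit along.
  · obtain h0 | hA0 := eq_or_ne ρA 0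
    · simp [h0]
    obtain h0 | hB0 := eq_or_ne ρB 0
    · simp [h0]
    have : (𝓝[<] ρA).NeBot := nhdsLT_neBot_of_exists_lt ⟨0, hA0.bot_lt⟩
    have : (𝓝[<] ρB).NeBot := nhdsLT_neBot_of_exists_lt ⟨0, hB0.bot_lt⟩
    have hinv : ∀ r : ℝ≥0∞, Tendsto (fun t : ℝ≥0∞ => t⁻¹) (𝓝[<] r) (𝓝 r⁻¹) := fun r =>
      (continuous_inv.tendsto r).mono_left nhdsWithin_le_nhds
    have hlim : Tendsto (fun z : ℝ≥0∞ × ℝ≥0∞ => z.1⁻¹ + z.2⁻¹) (𝓝[<] ρA ×ˢ 𝓝[<] ρB)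
        (𝓝 (ρA⁻¹ + ρB⁻¹)) :=
      ((hinv ρA).comp tendsto_fst).add ((hinv ρB).comp tendsto_snd)
    refine ge_of_tendsto hlim ?_
    filter_upwards [prod_mem_prod self_mem_nhdsWithin self_mem_nhdsWithin] with z hz
    exact InvGraph.inv_seriesRadius_freeProduct_le hA' hB' hz.1 hz.2
  · obtain h0 | h0 := eq_or_ne ρ 0
    · simp [h0]
    have : (𝓝[<] ρ).NeBot := nhdsLT_neBot_of_exists_lt ⟨0, h0.bot_lt⟩
    have hinv : Tendsto (fun t : ℝ≥0∞ => t⁻¹) (𝓝[<] ρ) (𝓝 ρ⁻¹) :=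
      (continuous_inv.tendsto ρ).mono_left nhdsWithin_le_nhds
    have hval : Tendsto (fun t => (seriesValue
        ((A.freeProduct B a b).circuitSeries (A.freeBase B a b)) t)⁻¹) (𝓝[<] ρ) (𝓝 0) := by
      rw [← ENNReal.inv_top]
      exact (continuous_inv.tendsto (∞ : ℝ≥0∞)).comp recAB
    -- Since `ρ ≠ 0`, the limit `ρ⁻¹` is finite and the product with a null function tends to 0.
    have hlim := hinv.add (ENNReal.Tendsto.mul hinv (Or.inr ENNReal.zero_ne_top) hval
      (Or.inr (ENNReal.inv_ne_top.2 h0)))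
    rw [mul_zero, add_zero] at hlim
    refine ge_of_tendsto hlim ?_
    filter_upwards [self_mem_nhdsWithin] with t ht
    exact InvGraph.add_inv_seriesRadius_le hA' hB' (seriesValue_lt_top ht)
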